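/- Let $n$ be a natural number and $p$ a positive integer. Let $q(n+1)$ be the complex Lie superalgebra with even basis elements $e_{ij}^{\bar 0}$ and odd basis elements $e_{ij}^{\bar 1}$ ($0\le i,j\le n$) and bracket $[\![ e_{ij}^\sigma,e_{kl}^\theta]\!]=\delta_{jk}e_{il}^{\sigma+\theta}-(-1)^{\sigma\theta}\delta_{il}e_{kj}^{\sigma+\theta}$, and put, for $1\le i\le n$, $b_i^+=e_{i0}^{\bar 0}$, $b_i^-=e_{0i}^{\bar 0}$, $f_i^+=e_{i0}^{\bar 1}$, $f_i^-=e_{0i}^{\bar 1}$. Modules are not required to be graded. Let $B$ be the subalgebra spanned by all $e_{ij}^\sigma$ except the $e_{i0}^{\sigma}$ with $i\ge 1$, and let $\mathbb{C}v_0$ be the one-dimensional $B$-module with $e_{00}^{\bar 0}v_0=p\,v_0$, $e_{00}^{\bar 1}v_0=\sqrt p\,v_0$, and $e_{ij}^\sigma v_0=0$ for all other basis elements of $B$. Let $\bar V_p=U(q(n+1))\otimes_{U(B)}\mathbb{C}v_0$ be the induced module, let $M_p$ be the sum of all submodules of $\bar V_p$ different from $\bar V_p$, and let $V_p=\bar V_p/M_p$.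 Then $M_p\neq\bar V_p$, so that $M_p$ is the largest submodule of $\bar V_p$ different from $\bar V_p$. There is exactly one Hermitian form $\langle\cdot|\cdot\rangle$ on $\bar V_p$ (conjugate-linear in the first argument) such that $\langle v_0|v_0\rangle=1$ and, for all $v,w\in\bar V_p$ and $1\le i\le n$, $$\langle b_i^+v|w\rangle=\langle v|b_i^-w\rangle,\qquad \langle f_i^+v|w\rangle=\langle v|f_i^-w\rangle .$$ This form vanishes on $M_p$, in the sense that $\langle v|w\rangle=\langle w|v\rangle=0$ for all $v\in M_p$ and $w\in\bar V_p$, and the Hermitian form that it induces on $V_p=\bar V_p/M_p$ is positive definite. -/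

import Mathlib

noncomputable section

namespace QFock

/-- The underlying space of the Lie superalgebra `q(n+1)`. The element `x` stands for the block
matrix with both diagonal blocks `x 0` (even part) and both off-diagonal blocks `x 1` (odd part);
rows and columns are indexed by `0, 1, …, n`. -/
abbrev Q (n : ℕ) : Type := ZMod 2 → Matrix (Fin (n + 1)) (Fin (n + 1)) ℂ

/-- The homogeneous element of parity `σ` given by the matrix `X`. -/
abbrev homog {n : ℕ} (σ : ZMod 2) (X : Matrix (Fin (n + 1)) (Fin (n + 1)) ℂ) : Q n :=
  Pi.single σ X

/-- The basis element `e_{ij}^σ` of `q(n+1)`. -/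
def e {n : ℕ} (σ : ZMod 2) (i j : Fin (n + 1)) : Q n := homog σ (Matrix.single i j 1)

/-- The Koszul sign `(-1)^{στ}`. -/
def koszul (σ τ : ZMod 2) : ℂ := (-1) ^ (σ.val * τ.val)

/-- The Lie superbracket of `q(n+1)`: the bilinear extension of the supercommutator
`XY - (-1)^{στ} YX` (of parity `σ + τ`) of homogeneous elements of parities `σ` and `τ`. -/
def superBracket {n : ℕ} (x y : Q n) : Q n :=
  ∑ σ : ZMod 2, ∑ τ : ZMod 2, homog (σ + τ) (x σ * y τ - koszul σ τ • (y τ * x σ))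

theorem superBracket_homog {n : ℕ} (σ τ : ZMod 2) (X Y : Matrix (Fin (n + 1)) (Fin (n + 1)) ℂ) :
    superBracket (homog σ X) (homog τ Y) = homog (σ + τ) (X * Y - koszul σ τ • (Y * X)) := by
  unfold superBracket
  rw [Finset.sum_eq_single σ, Finset.sum_eq_single τ]
  · simp
  · intro b _ hb
    simp [Pi.single_eq_of_ne hb]
  · simp
  · intro b _ hb
    simp [Pi.single_eq_of_ne hb]
  · simp

/-- The defining relations of the enveloping algebra:
`x y - (-1)^{στ} y x = ⟦x, y⟧` for `x`, `y` homogeneous of parities `σ`, `τ`. -/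
inductive EnvRel (n : ℕ) : TensorAlgebra ℂ (Q n) → TensorAlgebra ℂ (Q n) → Prop
  | supercomm (σ τ : ZMod 2) (X Y : Matrix (Fin (n + 1)) (Fin (n + 1)) ℂ) :
      EnvRel n
        (TensorAlgebra.ι ℂ (homog σ X) * TensorAlgebra.ι ℂ (homog τ Y)
          - koszul σ τ • (TensorAlgebra.ι ℂ (homog τ Y) * TensorAlgebra.ι ℂ (homog σ X)))
        (TensorAlgebra.ι ℂ (superBracket (homog σ X) (homog τ Y)))

/-- The universal enveloping algebra `U(q(n+1))`. A (not necessarily graded) `q(n+1)`-module is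
the same thing as a left module over it. -/
def U (n : ℕ) : Type := RingQuot (EnvRel n)

instance (n : ℕ) : Ring (U n) := inferInstanceAs (Ring (RingQuot (EnvRel n)))

instance (n : ℕ) : Algebra ℂ (U n) := inferInstanceAs (Algebra ℂ (RingQuot (EnvRel n)))

/-- The canonical map `q(n+1) → U(q(n+1))`. -/
def ι {n : ℕ} : Q n →ₗ[ℂ] U n :=
  (RingQuot.mkAlgHom ℂ (EnvRel n)).toLinearMap ∘ₗ TensorAlgebra.ι ℂ

/-- The creation operator `b_i⁺ = e_{i0}` (even), `i = 1, …, n`. -/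
def bPlus {n : ℕ} (i : Fin n) : U n := ι (e 0 i.succ 0)

/-- The annihilation operator `b_i⁻ = e_{0i}` (even). -/
def bMinus {n : ℕ} (i : Fin n) : U n := ι (e 0 0 i.succ)

/-- The creation operator `f_i⁺ = e_{i0}` (odd). -/
def fPlus {n : ℕ} (i : Fin n) : U n := ι (e 1 i.succ 0)

/-- The annihilation operator `f_i⁻ = e_{0i}` (odd). -/
def fMinus {n : ℕ} (i : Fin n) : U n := ι (e 1 0 i.succ)

/-- The subalgebra `q(1) ⊕ q(n) ⊕ P` of `q(n+1)`, where `P` is the span of the annihilation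
operators: the elements without components along the creation operators `e_{i0}^σ`, `i ≥ 1`. -/
def parabolic (n : ℕ) : Submodule ℂ (Q n) where
  carrier := {x | ∀ (σ : ZMod 2) (i : Fin n), x σ i.succ 0 = 0}
  add_mem' := by
    intro x y hx hy σ i
    simp [hx σ i, hy σ i]
  zero_mem' := by
    intro σ i
    simp
  smul_mem' := by
    intro c x hx σ i
    simp [hx σ i]

/-- The scalars by which the parabolic subalgebra acts on the one-dimensional module `ℂ v₀`:
`e_{00}` (even) acts by `p`, `e_{00}` (odd) by `√p`, and `q(n)` and `P` act by `0`. -/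
def vacuumChar {n : ℕ} (p : ℕ) (x : Q n) : ℂ :=
  (p : ℂ) * x 0 0 0 + ((Real.sqrt p : ℝ) : ℂ) * x 1 0 0

/-- The left ideal of `U(q(n+1))` generated by all `x - χ(x)`, `x` in the parabolic subalgebra,
where `χ` gives its action on `ℂ v₀`. -/
def inducingIdeal (n p : ℕ) : Submodule (U n) (U n) :=
  Submodule.span (U n)
    {u | ∃ x ∈ parabolic n, u = ι x - algebraMap ℂ (U n) (vacuumChar p x)}

/-- The induced module `V̄_p`: the tensor product over the enveloping algebra of the parabolic
subalgebra of `U(q(n+1))` with `ℂ v₀`, i.e. the quotient of `U(q(n+1))` by all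
`u x - χ(x) u` with `x` in the parabolic subalgebra. -/
abbrev VBar (n p : ℕ) : Type := U n ⧸ inducingIdeal n p

/-- The vacuum vector `v₀` (the class of `1 ⊗ v₀`). -/
def v₀ (n p : ℕ) : VBar n p := Submodule.Quotient.mk 1

/-- `M_p`: the largest submodule of `V̄_p` different from `V̄_p`, as the sum of all submodules
different from `V̄_p`. -/
def M (n p : ℕ) : Submodule (U n) (VBar n p) :=
  sSup {N : Submodule (U n) (VBar n p) | N ≠ ⊤}

/-- The quotient module `V_p = V̄_p / M_p`. -/
abbrev V (n p : ℕ) : Type := VBar n p ⧸ M n p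

/-- Sesquilinear forms on a complex vector space, conjugate-linear in the first argument. -/
abbrev SesqForm (W : Type) [AddCommGroup W] [Module ℂ W] : Type := W →ₗ⋆[ℂ] W →ₗ[ℂ] ℂ

/-- Hermitian symmetry `⟨w|v⟩ = conj ⟨v|w⟩`. -/
def IsHermitianForm {W : Type} [AddCommGroup W] [Module ℂ W] (H : SesqForm W) : Prop :=
  ∀ v w : W, H w v = starRingEnd ℂ (H v w)

/-- `H` is a Hermitian form on `V̄_p` with `⟨v₀|v₀⟩ = 1` for which `b_i⁻` is adjoint to `b_i⁺` and
`f_i⁻` is adjoint to `f_i⁺`. -/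
structure IsFockForm {n p : ℕ} (H : SesqForm (VBar n p)) : Prop where
  hermitian : IsHermitianForm H
  vacuum : H (v₀ n p) (v₀ n p) = 1
  adjoint_b : ∀ (i : Fin n) (v w : VBar n p), H (bPlus i • v) w = H v (bMinus i • w)
  adjoint_f : ∀ (i : Fin n) (v w : VBar n p), H (fPlus i • v) w = H v (fMinus i • w)

end QFock

end

/-!
The form is realized inside a tensor power on which positivity is evident. Both parities of
`q(n+1)` act on `ℂ^{n+1}` by the same matrices, since `e_{ij} ↦ E_{ij}` turns the odd brackets into
anticommutators. Twisting the odd action on the `a`-th factor of `(ℂ^{n+1})^{⊗p}` by the `a`-th of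
`p` anticommuting self-adjoint Clifford generators `c_a` with `c_a² = 1` gives a representation
`e_{ij}^0 ↦ ∑ E_{ij}^{(a)}`, `e_{ij}^1 ↦ ∑ E_{ij}^{(a)} c_a` (`Fock.act_supercomm`), in which
`e_{ij}^σ` and `e_{ji}^σ` are adjoint for the standard inner product (`Fock.inner_ι_e_smul`). As
`(∑ c_a)² = p`, the vector `(∑ c_a + √p) (e_0^{⊗p} ⊗ s)` is an eigenvector of the odd `e_{00}` with
eigenvalue `√p`, and the parabolic subalgebra acts on it as on the vacuum (`Fock.act_vac`). This
gives a homomorphism `toFock` from the induced module, along which the inner product pulls back to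
a Fock form.

The induced module is spanned by words of creation operators applied to `v₀` (`span_word`), and
moving creation operators across a Fock form gives its uniqueness (`IsFockForm.unique`). The even
`e_{00}` has eigenvalue `p - k` on words of length `k`, so a proper submodule has no vacuum
component (`le_excited_of_ne_top`); being stable under the annihilation operators, it lies in the
radical of every Fock form (`IsFockForm.apply_eq_zero_of_mem`). Since the inner product is definite,
the radical is the kernel of `toFock`, which is itself proper. Hence the kernel is `M n p`
(`M_eq_ker_toFock`), and the quotient embeds in the tensor power.
-/

noncomputable section

namespace QFock

open Polynomial

variable {n p : ℕ}

/-! ### Words of creation operators -/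

theorem ι_mul_ι (σ τ : ZMod 2) (X Y : Matrix (Fin (n + 1)) (Fin (n + 1)) ℂ) :
    (ι (homog σ X) * ι (homog τ Y) : U n) =
      koszul σ τ • (ι (homog τ Y) * ι (homog σ X))
        + ι (superBracket (homog σ X) (homog τ Y)) := by
  have h := RingQuot.mkAlgHom_rel ℂ (EnvRel.supercomm σ τ X Y)
  rw [map_sub, map_smul, map_mul, map_mul] at h
  exact sub_eq_iff_eq_add'.mp h

theorem adjoin_range_ι : Algebra.adjoin ℂ (Set.range (ι : Q n → U n)) = ⊤ := by
  rw [eq_top_iff]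
  rintro u -
  obtain ⟨t, rfl⟩ := RingQuot.mkAlgHom_surjective ℂ (EnvRel n) u
  induction t using TensorAlgebra.induction with
  | algebraMap r =>
    rw [AlgHom.commutes]
    exact Subalgebra.algebraMap_mem _ r
  | ι x => exact Algebra.subset_adjoin ⟨x, rfl⟩
  | mul a b ha hb =>
    rw [map_mul]
    exact mul_mem ha hb
  | add a b ha hb =>
    rw [map_add]
    exact add_mem ha hb

/-- The creation operator of parity `a.1` with index `a.2`. -/
def creation (a : ZMod 2 × Fin n) : U n := ι (e a.1 a.2.succ 0)

/-- The annihilation operator of parity `a.1` with index `a.2`. -/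
def annihilation (a : ZMod 2 × Fin n) : U n := ι (e a.1 0 a.2.succ)

theorem ι_smul_v₀ {x : Q n} (hx : x ∈ parabolic n) :
    ι x • v₀ n p = vacuumChar p x • v₀ n p := by
  have h : ι x - algebraMap ℂ (U n) (vacuumChar p x) ∈ inducingIdeal n p :=
    Submodule.subset_span ⟨x, hx, rfl⟩
  have h' := (Submodule.Quotient.mk_eq_zero _).mpr h
  rw [Submodule.Quotient.mk_sub, sub_eq_zero] at h'
  rw [← algebraMap_smul (U n) (vacuumChar p x) (v₀ n p), v₀,
    ← Submodule.Quotient.mk_smul, ← Submodule.Quotient.mk_smul]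
  simpa using h'

theorem smul_v₀_eq_mk (u : U n) : u • v₀ n p = Submodule.Quotient.mk u := by
  rw [v₀, ← Submodule.Quotient.mk_smul, smul_eq_mul, mul_one]

theorem annihilation_smul_v₀ (a : ZMod 2 × Fin n) : annihilation a • v₀ n p = 0 := by
  have hx : (e a.1 0 a.2.succ : Q n) ∈ parabolic n := by
    intro σ i
    by_cases h : σ = a.1
    · subst h
      simp [e]
    · simp [e, Pi.single_eq_of_ne h]
  rw [annihilation, ι_smul_v₀ hx]
  have : vacuumChar p (e a.1 0 a.2.succ : Q n) = 0 := by
    have h (σ : ZMod 2) : (e a.1 0 a.2.succ : Q n) σ 0 0 = 0 := by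
      by_cases h : σ = a.1
      · subst h
        simp [e]
      · simp [e, Pi.single_eq_of_ne h]
    simp [vacuumChar, h]
  rw [this, zero_smul]

/-- The vector obtained from `v₀` by applying a word of creation operators. -/
def word (p : ℕ) (L : List (ZMod 2 × Fin n)) : VBar n p :=
  L.foldr (fun a w => creation a • w) (v₀ n p)

@[simp]
theorem word_nil : word p ([] : List (ZMod 2 × Fin n)) = v₀ n p := rfl

@[simp]
theorem word_cons (a : ZMod 2 × Fin n) (L : List (ZMod 2 × Fin n)) :
    word p (a :: L) = creation a • word p L := rfl

theorem eq_sum_homog (x : Q n) : x = ∑ σ, homog σ (x σ) :=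
  (Finset.univ_sum_single x).symm

/-- Removing the components along the creation operators gives an element of the parabolic
subalgebra. -/
theorem sub_creation_mem_parabolic (x : Q n) :
    x - ∑ a : ZMod 2 × Fin n, x a.1 a.2.succ 0 • e a.1 a.2.succ 0 ∈ parabolic n := by
  intro σ i
  have h : (∑ a : ZMod 2 × Fin n, x a.1 a.2.succ 0 • e (n := n) a.1 a.2.succ 0) σ i.succ 0
      = x σ i.succ 0 := by
    rw [Finset.sum_apply, Matrix.sum_apply, Finset.sum_eq_single (σ, i)]
    · simp [e]
    · rintro ⟨τ, j⟩ - hne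
      by_cases h : σ = τ
      · subst h
        have hj : j ≠ i := fun h => hne (by rw [h])
        simp [e, hj]
      · simp [e, Pi.single_eq_of_ne h]
    · simp
  rw [Pi.sub_apply, Matrix.sub_apply, h, sub_self]

theorem smul_smul_left_comm (u : U n) (c : ℂ) (w : VBar n p) : u • c • w = c • u • w :=
  map_smul (Algebra.lsmul ℂ ℂ (VBar n p) u) c w

theorem smul_span_le {S : Set (VBar n p)} {F : Submodule ℂ (VBar n p)} (u : U n)
    (h : ∀ w ∈ S, u • w ∈ F) {w : VBar n p} (hw : w ∈ Submodule.span ℂ S) : u • w ∈ F := by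
  have : Submodule.span ℂ S ≤ F.comap (Algebra.lsmul ℂ ℂ (VBar n p) u) :=
    Submodule.span_le.mpr h
  exact this hw

/-- Commuting an element of the Lie superalgebra to the right through a word of creation
operators only produces shorter words. -/
theorem ι_smul_word_mem (L : List (ZMod 2 × Fin n)) (x : Q n) :
    ι x • word p L ∈ Submodule.span ℂ (Set.range (word (n := n) p)) := by
  induction L generalizing x with
  | nil =>
    have h := sub_creation_mem_parabolic x
    rw [← sub_add_cancel x (∑ a : ZMod 2 × Fin n, x a.1 a.2.succ 0 • e a.1 a.2.succ 0), map_add,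
      add_smul, word_nil, ι_smul_v₀ h, map_sum, Finset.sum_smul]
    refine add_mem (Submodule.smul_mem _ _ (Submodule.subset_span ⟨[], rfl⟩))
      (sum_mem fun a _ => ?_)
    rw [map_smul, smul_assoc]
    exact Submodule.smul_mem _ _ (Submodule.subset_span ⟨[a], rfl⟩)
  | cons a L ih =>
    rw [eq_sum_homog x, map_sum, Finset.sum_smul]
    refine sum_mem fun σ _ => ?_
    rw [word_cons, ← mul_smul, creation, e, ι_mul_ι, add_smul, smul_assoc]
    refine add_mem (Submodule.smul_mem _ _ ?_) (ih _)
    rw [mul_smul]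
    refine smul_span_le _ ?_ (ih (homog σ (x σ)))
    rintro _ ⟨L', rfl⟩
    exact Submodule.subset_span ⟨a :: L', rfl⟩

theorem span_word : Submodule.span ℂ (Set.range (word (n := n) p)) = ⊤ := by
  set F := Submodule.span ℂ (Set.range (word (n := n) p)) with hF
  have key (u : U n) : ∀ w ∈ F, u • w ∈ F := by
    have hu : u ∈ Algebra.adjoin ℂ (Set.range (ι : Q n → U n)) := by
      rw [adjoin_range_ι]
      trivial
    induction hu using Algebra.adjoin_induction with
    | mem y hy =>
      obtain ⟨x, rfl⟩ := hy
      intro w hw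
      refine smul_span_le _ ?_ hw
      rintro _ ⟨L, rfl⟩
      exact ι_smul_word_mem L x
    | algebraMap r =>
      intro w hw
      rw [algebraMap_smul]
      exact F.smul_mem r hw
    | add a b _ _ ha hb =>
      intro w hw
      rw [add_smul]
      exact add_mem (ha w hw) (hb w hw)
    | mul a b _ _ ha hb =>
      intro w hw
      rw [mul_smul]
      exact ha _ (hb w hw)
  rw [eq_top_iff]
  rintro w -
  obtain ⟨u, rfl⟩ := Submodule.Quotient.mk_surjective _ w
  rw [← smul_v₀_eq_mk]
  exact key u _ (Submodule.subset_span ⟨[], rfl⟩)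

/-- The span of the nonempty words of creation operators applied to the vacuum. -/
def excited (n p : ℕ) : Submodule ℂ (VBar n p) :=
  Submodule.span ℂ {w | ∃ a L, w = word p (a :: L)}

theorem exists_eq_smul_v₀_add (v : VBar n p) : ∃ c : ℂ, ∃ r ∈ excited n p, v = c • v₀ n p + r := by
  have hv : v ∈ Submodule.span ℂ (Set.range (word (n := n) p)) := by
    rw [span_word]
    trivial
  have hle : Submodule.span ℂ (Set.range (word (n := n) p))
      ≤ Submodule.span ℂ {v₀ n p} ⊔ excited n p := by
    rw [Submodule.span_le]
    rintro _ ⟨L, rfl⟩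
    cases L with
    | nil => exact Submodule.mem_sup_left (Submodule.mem_span_singleton_self _)
    | cons a L => exact Submodule.mem_sup_right (Submodule.subset_span ⟨a, L, rfl⟩)
  obtain ⟨y, hy, r, hr, rfl⟩ := Submodule.mem_sup.mp (hle hv)
  obtain ⟨c, rfl⟩ := Submodule.mem_span_singleton.mp hy
  exact ⟨c, r, hr, rfl⟩

/-! ### The grading by the even element `e_{00}` -/

theorem ι_e_zero_mul_creation (a : ZMod 2 × Fin n) :
    (ι (e 0 0 0) * creation a : U n) = creation a * ι (e 0 0 0) - creation a := by
  rw [creation, e, e, ι_mul_ι, superBracket_homog]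
  rw [Matrix.single_mul_single_of_ne _ _ _ _ (Fin.succ_ne_zero a.2).symm]
  simp [koszul, sub_eq_add_neg, Pi.single_neg]

theorem ι_e_zero_smul_v₀ : (ι (e 0 0 0) : U n) • v₀ n p = (p : ℂ) • v₀ n p := by
  have hx : (e 0 0 0 : Q n) ∈ parabolic n := by
    intro σ i
    by_cases h : σ = 0
    · subst h
      simp [e, (Fin.succ_ne_zero i).symm]
    · simp [e, Pi.single_eq_of_ne h]
  rw [ι_smul_v₀ hx]
  simp [vacuumChar, e]

theorem ι_e_zero_smul_word (L : List (ZMod 2 × Fin n)) :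
    (ι (e 0 0 0) : U n) • word p L = ((p : ℂ) - L.length) • word p L := by
  induction L with
  | nil => simp [ι_e_zero_smul_v₀]
  | cons a L ih =>
    rw [word_cons, ← mul_smul, ι_e_zero_mul_creation, sub_smul, mul_smul, ih,
      smul_smul_left_comm (creation a)]
    simp only [List.length_cons, Nat.cast_add, Nat.cast_one]
    generalize creation a • word p L = y
    module

theorem aeval_smul_of_smul_eq {d : U n} {w : VBar n p} {c : ℂ} (h : d • w = c • w)
    (P : ℂ[X]) : aeval d P • w = P.eval c • w := by
  induction P using Polynomial.induction_on' with
  | add P R hP hR => rw [map_add, add_smul, hP, hR, eval_add, add_smul]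
  | monomial k q =>
    rw [aeval_monomial, eval_monomial, mul_smul, algebraMap_smul, mul_smul]
    congr 1
    induction k with
    | zero => simp
    | succ k ih => rw [pow_succ, mul_smul, h, smul_smul_left_comm, ih, smul_smul, pow_succ']

/-- An excited vector is killed by a polynomial in `e_{00}` that does not vanish at the
eigenvalue `p` of the vacuum. -/
theorem exists_aeval_smul_eq_zero {r : VBar n p} (hr : r ∈ excited n p) :
    ∃ P : ℂ[X], P.eval (p : ℂ) ≠ 0 ∧ aeval (ι (e 0 0 0) : U n) P • r = 0 := by
  induction hr using Submodule.span_induction with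
  | mem w hw =>
    obtain ⟨a, L, rfl⟩ := hw
    refine ⟨X - C ((p : ℂ) - (a :: L).length), ?_, ?_⟩
    · simp only [eval_sub, eval_X, eval_C, sub_sub_cancel]
      exact Nat.cast_ne_zero.mpr (Nat.succ_ne_zero L.length)
    · rw [aeval_smul_of_smul_eq (ι_e_zero_smul_word _)]
      simp
  | zero => exact ⟨1, by simp, by simp⟩
  | add x y _ _ hx hy =>
    obtain ⟨P, hP, hPx⟩ := hx
    obtain ⟨R, hR, hRy⟩ := hy
    refine ⟨P * R, by simp [hP, hR], ?_⟩
    rw [smul_add, mul_comm P R, map_mul, mul_smul, hPx, ← map_mul, mul_comm R P, map_mul,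
      mul_smul, hRy, smul_zero, smul_zero, add_zero]
  | smul c x _ hx =>
    obtain ⟨P, hP, hPx⟩ := hx
    exact ⟨P, hP, by rw [smul_smul_left_comm, hPx, smul_zero]⟩

/-- A vector of a proper submodule has no vacuum component, since the action of a polynomial in
`e_{00}` would isolate it and `v₀` generates the induced module. -/
theorem le_excited_of_ne_top {N : Submodule (U n) (VBar n p)} (hN : N ≠ ⊤) :
    N.restrictScalars ℂ ≤ excited n p := by
  intro v hv
  obtain ⟨c, r, hr, rfl⟩ := exists_eq_smul_v₀_add v
  by_cases hc : c = 0
  · simpa [hc] using hr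
  obtain ⟨P, hP, hPr⟩ := exists_aeval_smul_eq_zero hr
  refine absurd ?_ hN
  have h : aeval (ι (e 0 0 0) : U n) P • (c • v₀ n p + r) ∈ N := N.smul_mem _ hv
  rw [smul_add, hPr, add_zero, smul_smul_left_comm,
    aeval_smul_of_smul_eq ι_e_zero_smul_v₀, smul_smul] at h
  have hv₀ : v₀ n p ∈ N := by
    have := (N.restrictScalars ℂ).smul_mem (c * P.eval (p : ℂ))⁻¹ h
    rwa [smul_smul, inv_mul_cancel₀ (mul_ne_zero hc hP), one_smul] at this
  rw [eq_top_iff]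
  rintro w -
  obtain ⟨u, rfl⟩ := Submodule.Quotient.mk_surjective _ w
  rw [← smul_v₀_eq_mk]
  exact N.smul_mem u hv₀

/-! ### Fock forms -/

namespace IsFockForm

variable {H : SesqForm (VBar n p)}

theorem adjoint (hH : IsFockForm H) (a : ZMod 2 × Fin n) (v w : VBar n p) :
    H (creation a • v) w = H v (annihilation a • w) := by
  obtain ⟨σ, i⟩ := a
  fin_cases σ
  · exact hH.adjoint_b i v w
  · exact hH.adjoint_f i v w

theorem excited_v₀ (hH : IsFockForm H) {r : VBar n p} (hr : r ∈ excited n p) :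
    H r (v₀ n p) = 0 := by
  induction hr using Submodule.span_induction with
  | mem w hw =>
    obtain ⟨a, L, rfl⟩ := hw
    rw [word_cons, hH.adjoint, annihilation_smul_v₀, map_zero]
  | zero => simp
  | add x y _ _ hx hy => rw [map_add, LinearMap.add_apply, hx, hy, add_zero]
  | smul c x _ hx => rw [LinearMap.map_smulₛₗ, LinearMap.smul_apply, hx, smul_zero]

theorem unique {H' : SesqForm (VBar n p)} (hH : IsFockForm H) (hH' : IsFockForm H') : H = H' := by
  have h₀ (w : VBar n p) : H (v₀ n p) w = H' (v₀ n p) w := by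
    obtain ⟨c, r, hr, rfl⟩ := exists_eq_smul_v₀_add w
    rw [map_add, map_add, map_smul, map_smul, hH.vacuum, hH'.vacuum, hH.hermitian r,
      hH'.hermitian r, hH.excited_v₀ hr, hH'.excited_v₀ hr]
  have hword (L : List (ZMod 2 × Fin n)) : ∀ w, H (word p L) w = H' (word p L) w := by
    induction L with
    | nil => exact h₀
    | cons a L ih =>
      intro w
      rw [word_cons, hH.adjoint, hH'.adjoint, ih]
  exact LinearMap.ext_on_range span_word fun L => LinearMap.ext (hword L)

/-- Every Fock form vanishes on proper submodules, because these are stable under the annihilation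
operators and contain only excited vectors, which are orthogonal to `v₀`. -/
theorem apply_eq_zero_of_mem (hH : IsFockForm H) {N : Submodule (U n) (VBar n p)} (hN : N ≠ ⊤)
    {v : VBar n p} (hv : v ∈ N) (w : VBar n p) : H v w = 0 := by
  have key (L : List (ZMod 2 × Fin n)) : ∀ v ∈ N, H v (word p L) = 0 := by
    induction L with
    | nil => exact fun v hv => hH.excited_v₀ (le_excited_of_ne_top hN hv)
    | cons a L ih =>
      intro v hv
      rw [hH.hermitian, word_cons, hH.adjoint, ← hH.hermitian]
      exact ih _ (N.smul_mem _ hv)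
  have : H v = 0 := LinearMap.ext_on_range span_word fun L => by simp [key L v hv]
  rw [this, LinearMap.zero_apply]

end IsFockForm

/-! ### The Clifford-twisted tensor power -/

/-- The space `(ℂ^{n+1})^{⊗p} ⊗ (ℂ²)^{⊗p}`, as functions of the indices of the tensor factors. The
second tensor power carries a representation of the Clifford algebra on `p` generators. -/
def Fock (n p : ℕ) : Type := (Fin p → Fin (n + 1)) × (Fin p → ZMod 2) → ℂ

instance (n p : ℕ) : AddCommGroup (Fock n p) :=
  inferInstanceAs (AddCommGroup ((Fin p → Fin (n + 1)) × (Fin p → ZMod 2) → ℂ))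

instance (n p : ℕ) : Module ℂ (Fock n p) :=
  inferInstanceAs (Module ℂ ((Fin p → Fin (n + 1)) × (Fin p → ZMod 2) → ℂ))

namespace Fock

/-- The element of the space with the given components. -/
def mk (f : (Fin p → Fin (n + 1)) × (Fin p → ZMod 2) → ℂ) : Fock n p := f

@[simp]
theorem mk_apply (f : (Fin p → Fin (n + 1)) × (Fin p → ZMod 2) → ℂ) (x) : mk f x = f x := rfl

@[ext]
theorem ext {f g : Fock n p} (h : ∀ x, f x = g x) : f = g := funext h

@[simp]
theorem add_apply (f g : Fock n p) (x) : (f + g) x = f x + g x := rfl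

@[simp]
theorem smul_apply (c : ℂ) (f : Fock n p) (x) : (c • f) x = c * f x := rfl

@[simp]
theorem neg_apply (f : Fock n p) (x) : (-f) x = -f x := rfl

theorem sum_apply {α : Type*} (s : Finset α) (f : α → Fock n p) (x) :
    (∑ a ∈ s, f a) x = ∑ a ∈ s, f a x := Finset.sum_apply x s f

/-- A matrix acting on the `a`-th factor of `(ℂ^{n+1})^{⊗p}`. -/
def site (a : Fin p) : Matrix (Fin (n + 1)) (Fin (n + 1)) ℂ →ₗ[ℂ] Module.End ℂ (Fock n p) :=
  LinearMap.mk₂ ℂ (fun X f => mk fun x => ∑ j, X (x.1 a) j * f (Function.update x.1 a j, x.2))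
    (fun X Y f => by
      ext x
      simp [add_mul, Finset.sum_add_distrib])
    (fun c X f => by
      ext x
      simp [Finset.mul_sum, mul_assoc])
    (fun X f g => by
      ext x
      simp [mul_add, Finset.sum_add_distrib])
    (fun c X f => by
      ext x
      simp [Finset.mul_sum, mul_left_comm])

theorem site_apply (a : Fin p) (X : Matrix (Fin (n + 1)) (Fin (n + 1)) ℂ) (f : Fock n p) (x) :
    site a X f x = ∑ j, X (x.1 a) j * f (Function.update x.1 a j, x.2) := rfl

theorem site_mul (a : Fin p) (X Y : Matrix (Fin (n + 1)) (Fin (n + 1)) ℂ) :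
    site a X * site a Y = site a (X * Y) := by
  ext f x
  simp only [Module.End.mul_apply, site_apply, Matrix.mul_apply, Function.update_self,
    Function.update_idem, Finset.mul_sum, Finset.sum_mul]
  rw [Finset.sum_comm]
  simp only [mul_assoc]

theorem site_commute {a b : Fin p} (h : a ≠ b) (X Y : Matrix (Fin (n + 1)) (Fin (n + 1)) ℂ) :
    Commute (site a X) (site b Y) := by
  ext f x
  simp only [Module.End.mul_apply, site_apply, Finset.mul_sum, Function.update_of_ne h,
    Function.update_of_ne h.symm]
  rw [Finset.sum_comm]
  refine Finset.sum_congr rfl fun j _ => Finset.sum_congr rfl fun k _ => ?_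
  rw [Function.update_comm h, mul_left_comm]

/-- The Jordan–Wigner sign `(-1)^{∑_{b < a} s_b}`. -/
def jwSign (a : Fin p) (s : Fin p → ZMod 2) : ℂ :=
  ∏ b ∈ Finset.univ.filter (· < a), (-1) ^ (s b).val

theorem eq_zero_or_eq_one (σ : ZMod 2) : σ = 0 ∨ σ = 1 := by
  revert σ
  decide

theorem neg_one_pow_val_add_one (t : ZMod 2) : (-1 : ℂ) ^ (t + 1).val = -(-1) ^ t.val := by
  rcases eq_zero_or_eq_one t with rfl | rfl
  · simp [ZMod.val_one]
  · simp [show (1 : ZMod 2) + 1 = 0 from rfl, ZMod.val_one]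

theorem jwSign_mul_self (a : Fin p) (s : Fin p → ZMod 2) : jwSign a s * jwSign a s = 1 := by
  rw [jwSign, ← Finset.prod_mul_distrib]
  refine Finset.prod_eq_one fun b _ => ?_
  rw [← pow_add, ← two_mul, pow_mul]
  simp

theorem star_jwSign (a : Fin p) (s : Fin p → ZMod 2) :
    starRingEnd ℂ (jwSign a s) = jwSign a s := by
  simp [jwSign]

theorem jwSign_add_single_of_le {a b : Fin p} (h : a ≤ b) (s : Fin p → ZMod 2) :
    jwSign a (s + Pi.single b 1) = jwSign a s := by
  refine Finset.prod_congr rfl fun c hc => ?_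
  have hcb : c ≠ b := (lt_of_lt_of_le (Finset.mem_filter.mp hc).2 h).ne
  simp [Pi.single_eq_of_ne hcb]

theorem jwSign_add_single_of_lt {a b : Fin p} (h : b < a) (s : Fin p → ZMod 2) :
    jwSign a (s + Pi.single b 1) = -jwSign a s := by
  have hb : b ∈ Finset.univ.filter (· < a) := by simpa using h
  rw [jwSign, jwSign, ← Finset.mul_prod_erase _ _ hb, ← Finset.mul_prod_erase _ _ hb, ← neg_mul]
  congr 1
  · simp [neg_one_pow_val_add_one]
  · refine Finset.prod_congr rfl fun c hc => ?_
    simp [Pi.single_eq_of_ne (Finset.ne_of_mem_erase hc)]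

theorem add_single_add_single (s : Fin p → ZMod 2) (a : Fin p) :
    s + Pi.single a 1 + Pi.single a 1 = s := by
  rw [add_assoc, ← Pi.single_add, CharTwo.add_self_eq_zero, Pi.single_zero, add_zero]

/-- The Jordan–Wigner representation of the `a`-th Clifford generator. -/
def clifford (a : Fin p) : Module.End ℂ (Fock n p) where
  toFun f := mk fun x => jwSign a x.2 * f (x.1, x.2 + Pi.single a 1)
  map_add' f g := by
    ext x
    simp [mul_add]
  map_smul' c f := by
    ext x
    simp [mul_left_comm]

theorem clifford_apply (a : Fin p) (f : Fock n p) (x) :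
    clifford a f x = jwSign a x.2 * f (x.1, x.2 + Pi.single a 1) := rfl

theorem clifford_mul_self (a : Fin p) : clifford a * clifford a = (1 : Module.End ℂ (Fock n p)) := by
  ext f x
  simp only [Module.End.mul_apply, clifford_apply, Module.End.one_apply]
  rw [jwSign_add_single_of_le le_rfl, add_single_add_single, ← mul_assoc, jwSign_mul_self, one_mul]

theorem clifford_anticomm {a b : Fin p} (h : a ≠ b) :
    clifford a * clifford b = -(clifford b * clifford a : Module.End ℂ (Fock n p)) := by
  ext f x
  simp only [Module.End.mul_apply, clifford_apply, LinearMap.neg_apply, neg_apply]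
  rw [add_right_comm]
  rcases lt_or_gt_of_ne h with h | h
  · rw [jwSign_add_single_of_lt h, jwSign_add_single_of_le h.le]
    ring
  · rw [jwSign_add_single_of_lt h, jwSign_add_single_of_le h.le]
    ring

theorem site_commute_clifford (a b : Fin p) (X : Matrix (Fin (n + 1)) (Fin (n + 1)) ℂ) :
    Commute (site a X) (clifford b) := by
  ext f x
  simp only [Module.End.mul_apply, site_apply, clifford_apply, Finset.mul_sum]
  exact Finset.sum_congr rfl fun j _ => mul_left_comm _ _ _

/-! ### The action of the Lie superalgebra -/

/-- The action of the Lie superalgebra: even matrices act as derivations of the tensor power, and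
an odd matrix acts on the `a`-th factor together with the `a`-th Clifford generator. -/
def act : Q n →ₗ[ℂ] Module.End ℂ (Fock n p) :=
  ∑ a : Fin p, (site (n := n) (p := p) a ∘ₗ LinearMap.proj (φ := fun _ : ZMod 2 => _) 0
    + LinearMap.mulRight ℂ (clifford (n := n) (p := p) a) ∘ₗ site (n := n) (p := p) a ∘ₗ
      LinearMap.proj (φ := fun _ : ZMod 2 => _) 1)

theorem act_apply (x : Q n) :
    act x = ∑ a, (site (p := p) a (x 0) + site a (x 1) * clifford a) := by
  simp [act]

theorem act_homog (σ : ZMod 2) (X : Matrix (Fin (n + 1)) (Fin (n + 1)) ℂ) :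
    act (homog σ X) = ∑ a, site (p := p) a X * clifford a ^ σ.val := by
  rw [act_apply]
  refine Finset.sum_congr rfl fun a _ => ?_
  rcases eq_zero_or_eq_one σ with rfl | rfl
  · simp
  · simp [ZMod.val_one]

theorem site_clifford_supercomm (σ τ : ZMod 2) (X Y : Matrix (Fin (n + 1)) (Fin (n + 1)) ℂ)
    (a b : Fin p) :
    site a X * clifford a ^ σ.val * (site b Y * clifford b ^ τ.val)
      - koszul σ τ • (site b Y * clifford b ^ τ.val * (site a X * clifford a ^ σ.val)) =
    if a = b then site a (X * Y - koszul σ τ • (Y * X)) * clifford a ^ (σ + τ).val else 0 := by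
  rw [((site_commute_clifford b a Y).symm.pow_left _).mul_mul_mul_comm,
    ((site_commute_clifford a b X).symm.pow_left _).mul_mul_mul_comm]
  split_ifs with h
  · subst h
    have hc : (clifford a ^ σ.val * clifford a ^ τ.val : Module.End ℂ (Fock n p))
        = clifford a ^ (σ + τ).val := by
      rcases eq_zero_or_eq_one σ with rfl | rfl <;>
        rcases eq_zero_or_eq_one τ with rfl | rfl <;>
        simp [ZMod.val_one, clifford_mul_self, show (1 : ZMod 2) + 1 = 0 from rfl]
    rw [site_mul, site_mul, hc, ← pow_add, add_comm τ.val, pow_add, hc, map_sub, map_smul, sub_mul,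
      smul_mul_assoc]
  · have hc : (clifford a ^ σ.val * clifford b ^ τ.val : Module.End ℂ (Fock n p))
        = koszul σ τ • (clifford b ^ τ.val * clifford a ^ σ.val) := by
      rcases eq_zero_or_eq_one σ with rfl | rfl <;>
        rcases eq_zero_or_eq_one τ with rfl | rfl <;>
        simp [ZMod.val_one, koszul, clifford_anticomm h]
    rw [(site_commute h X Y).eq, hc, mul_smul_comm, sub_self]

theorem act_supercomm (σ τ : ZMod 2) (X Y : Matrix (Fin (n + 1)) (Fin (n + 1)) ℂ) :
    act (homog σ X) * act (homog τ Y) - koszul σ τ • (act (homog τ Y) * act (homog σ X))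
      = act (p := p) (superBracket (homog σ X) (homog τ Y)) := by
  rw [superBracket_homog, act_homog, act_homog, act_homog, Finset.sum_mul_sum, Finset.sum_mul_sum,
    Finset.sum_comm (f := fun b a => site b Y * clifford b ^ τ.val *
      (site a X * clifford a ^ σ.val)), Finset.smul_sum, ← Finset.sum_sub_distrib]
  refine Finset.sum_congr rfl fun a _ => ?_
  rw [Finset.smul_sum, ← Finset.sum_sub_distrib]
  simp only [site_clifford_supercomm, Finset.sum_ite_eq, Finset.mem_univ, if_true]

/-- The extension of the action to the enveloping algebra. -/
def rep (n p : ℕ) : U n →ₐ[ℂ] Module.End ℂ (Fock n p) :=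
  RingQuot.liftAlgHom ℂ ⟨TensorAlgebra.lift ℂ act, by
    rintro _ _ ⟨σ, τ, X, Y⟩
    simp only [map_sub, map_smul, map_mul, TensorAlgebra.lift_ι_apply]
    exact act_supercomm σ τ X Y⟩

theorem rep_ι (x : Q n) : rep n p (ι x) = act x := by
  have h := RingQuot.liftAlgHom_mkAlgHom_apply ℂ (TensorAlgebra.lift ℂ (act (n := n) (p := p)))
    (s := EnvRel n) (by
      rintro _ _ ⟨σ, τ, X, Y⟩
      simp only [map_sub, map_smul, map_mul, TensorAlgebra.lift_ι_apply]
      exact act_supercomm σ τ X Y) (TensorAlgebra.ι ℂ x)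
  rw [TensorAlgebra.lift_ι_apply] at h
  exact h

instance : Module (U n) (Fock n p) := Module.compHom _ (rep n p).toRingHom

theorem smul_def (u : U n) (f : Fock n p) : u • f = rep n p u f := rfl

instance : IsScalarTower ℂ (U n) (Fock n p) where
  smul_assoc c u f := by
    rw [smul_def, smul_def, map_smul, LinearMap.smul_apply]

theorem ι_smul (x : Q n) (f : Fock n p) : ι x • f = act x f := by
  rw [smul_def, rep_ι]

/-! ### The inner product -/

/-- The standard inner product, for which the basis of indices is orthonormal. -/
def inner (n p : ℕ) : SesqForm (Fock n p) :=
  LinearMap.mk₂'ₛₗ (starRingEnd ℂ) (RingHom.id ℂ) (fun f g => ∑ x, starRingEnd ℂ (f x) * g x)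
    (fun f f' g => by simp [add_mul, Finset.sum_add_distrib])
    (fun c f g => by simp [Finset.mul_sum, mul_assoc])
    (fun f g g' => by simp [mul_add, Finset.sum_add_distrib])
    (fun c f g => by simp [Finset.mul_sum, mul_left_comm])

theorem inner_apply (f g : Fock n p) : inner n p f g = ∑ x, starRingEnd ℂ (f x) * g x := rfl

theorem inner_hermitian : IsHermitianForm (inner n p) := by
  intro f g
  simp [inner_apply, mul_comm]

theorem inner_self (f : Fock n p) : inner n p f f = ((∑ x, ‖f x‖ ^ 2 : ℝ) : ℂ) := by
  rw [inner_apply, Complex.ofReal_sum]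
  refine Finset.sum_congr rfl fun x _ => ?_
  rw [← Complex.normSq_eq_conj_mul_self, Complex.normSq_eq_norm_sq]

theorem sum_norm_sq_pos {f : Fock n p} (hf : f ≠ 0) : 0 < ∑ x, ‖f x‖ ^ 2 := by
  obtain ⟨x, hx⟩ : ∃ x, f x ≠ 0 := by
    by_contra! h
    exact hf (ext h)
  exact Finset.sum_pos' (fun _ _ => by positivity) ⟨x, Finset.mem_univ x, by positivity⟩

theorem inner_site (a : Fin p) (X : Matrix (Fin (n + 1)) (Fin (n + 1)) ℂ) (f g : Fock n p) :
    inner n p (site a X f) g = inner n p f (site a X.conjTranspose g) := by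
  simp only [inner_apply, site_apply, map_sum, map_mul, Finset.sum_mul, Finset.mul_sum,
    Matrix.conjTranspose_apply]
  rw [← Fintype.sum_prod_type', ← Fintype.sum_prod_type']
  -- Exchange the `a`-th index with the summation index of the matrix product.
  refine Fintype.sum_bijective
    (fun y => ((Function.update y.1.1 a y.2, y.1.2), y.1.1 a)) ?_ _ _ ?_
  · refine Function.Involutive.bijective fun y => ?_
    simp
  · rintro ⟨⟨i, s⟩, j⟩
    simp only [Function.update_self, Function.update_idem, Function.update_eq_self]
    simp only [starRingEnd_apply]
    ring

theorem inner_clifford (a : Fin p) (f g : Fock n p) :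
    inner n p (clifford a f) g = inner n p f (clifford a g) := by
  simp only [inner_apply, clifford_apply, map_mul, star_jwSign]
  refine Fintype.sum_bijective (fun y => (y.1, y.2 + Pi.single a 1)) ?_ _ _ ?_
  · refine Function.Involutive.bijective fun y => ?_
    simp [add_single_add_single]
  · rintro ⟨i, s⟩
    simp only [add_single_add_single, jwSign_add_single_of_le le_rfl]
    ring

theorem inner_act (x : Q n) (f g : Fock n p) :
    inner n p (act x f) g = inner n p f (act (fun σ => (x σ).conjTranspose) g) := by
  simp only [act_apply, LinearMap.sum_apply, LinearMap.add_apply, Module.End.mul_apply, map_sum,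
    map_add]
  refine Finset.sum_congr rfl fun a _ => ?_
  rw [inner_site, inner_site, inner_clifford, ← Module.End.mul_apply (clifford a),
    ← (site_commute_clifford a a _).eq, Module.End.mul_apply]

theorem inner_ι_e_smul (σ : ZMod 2) (i j : Fin (n + 1)) (f g : Fock n p) :
    inner n p ((ι (e σ i j) : U n) • f) g = inner n p f ((ι (e σ j i) : U n) • g) := by
  rw [ι_smul, ι_smul, inner_act]
  congr 3
  funext τ
  by_cases h : τ = σ
  · subst h
    simp [e]
  · simp [e, Pi.single_eq_of_ne h]

/-! ### The vacuum of the tensor power -/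

theorem sum_clifford_mul_self :
    (∑ a, clifford a) * (∑ a, clifford a) = ((p : ℂ) • 1 : Module.End ℂ (Fock n p)) := by
  -- The product is half the sum of all anticommutators, of which only the diagonal survives.
  have h := act_supercomm (n := n) (p := p) 1 1 1 1
  have hs (a : Fin p) : site a (1 : Matrix (Fin (n + 1)) (Fin (n + 1)) ℂ) = 1 := by
    ext f x
    simp [site_apply, Matrix.one_apply]
  rw [superBracket_homog, act_homog, act_homog] at h
  simp only [hs, mul_one, one_mul, koszul, ZMod.val_one, pow_one,
    show (1 : ZMod 2) + 1 = 0 from rfl, ZMod.val_zero, pow_zero, neg_smul, one_smul,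
    sub_neg_eq_add, ← two_smul ℂ] at h
  simp only [map_smul, hs, Finset.sum_const, Finset.card_univ, Fintype.card_fin] at h
  rw [← Nat.cast_smul_eq_nsmul ℂ p, smul_comm] at h
  exact smul_right_injective _ two_ne_zero h

/-- The basis vector all of whose indices are zero. -/
def base (n p : ℕ) : Fock n p := mk fun x => if x = (0, 0) then 1 else 0

theorem site_base {X : Matrix (Fin (n + 1)) (Fin (n + 1)) ℂ} (hX : ∀ i : Fin n, X i.succ 0 = 0)
    (a : Fin p) : site a X (base n p) = X 0 0 • base n p := by
  ext ⟨i, s⟩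
  rw [site_apply, Finset.sum_eq_single 0]
  · simp only [base, smul_apply]
    rcases Fin.eq_zero_or_eq_succ (i a) with h | ⟨k, h⟩
    · rw [h, ← h, Function.update_eq_self]
    · have : i ≠ 0 := fun h' => by simp [h'] at h; exact (Fin.succ_ne_zero k h.symm).elim
      simp [h, hX, this]
  · intro j _ hj
    have : Function.update i a j ≠ 0 := fun h => hj (by simpa using congrFun h a)
    simp [base, this]
  · simp

/-- An eigenvector of the sum of the Clifford generators with eigenvalue `√p`. The sum squares to
`p`, so that `∑ c_a + √p` maps into the eigenspace. -/
def vac (n p : ℕ) : Fock n p :=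
  (∑ a, clifford a + ((Real.sqrt p : ℝ) : ℂ) • 1 : Module.End ℂ (Fock n p)) (base n p)

theorem vac_ne_zero (hp : 0 < p) : vac n p ≠ 0 := by
  intro h
  have h0 : vac n p (0, 0) = 0 := congrFun h (0, 0)
  have hs (a : Fin p) : (Pi.single a 1 : Fin p → ZMod 2) ≠ 0 := by simp
  have hp' : ((Real.sqrt p : ℝ) : ℂ) ≠ 0 := by
    simpa using hp.ne'
  rw [vac, LinearMap.add_apply, LinearMap.sum_apply, LinearMap.smul_apply,
    Module.End.one_apply, add_apply, sum_apply, smul_apply] at h0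
  simp [clifford_apply, base, hs, hp'] at h0

theorem act_vac {x : Q n} (hx : x ∈ parabolic n) :
    act x (vac n p) = vacuumChar p x • vac n p := by
  set C : Module.End ℂ (Fock n p) := ∑ a, clifford a with hC
  set r : ℂ := ((Real.sqrt p : ℝ) : ℂ) with hr
  have hrr : r * r = p := by
    rw [hr, ← Complex.ofReal_mul, Real.mul_self_sqrt (Nat.cast_nonneg p), Complex.ofReal_natCast]
  have hvac : vac n p = C (base n p) + r • base n p := rfl
  have hCv : C (vac n p) = r • vac n p := by
    rw [hvac, map_add, map_smul, ← Module.End.mul_apply, sum_clifford_mul_self, smul_add, smul_smul,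
      hrr, add_comm]
    rfl
  have hsite (σ : ZMod 2) (a : Fin p) : site a (x σ) (vac n p) = x σ 0 0 • vac n p := by
    have hcomm : Commute (site a (x σ)) C :=
      Commute.sum_right _ _ _ fun b _ => site_commute_clifford a b _
    rw [hvac, map_add, map_smul, ← Module.End.mul_apply, hcomm.eq, Module.End.mul_apply,
      site_base (hx σ), map_smul, smul_add, smul_comm r]
  rw [act_apply, LinearMap.sum_apply]
  simp only [LinearMap.add_apply, (site_commute_clifford _ _ _).eq, Module.End.mul_apply, hsite,
    map_smul]
  rw [Finset.sum_add_distrib, ← Finset.smul_sum (r := x 1 0 0), ← LinearMap.sum_apply, ← hC, hCv]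
  simp only [Finset.sum_const, Finset.card_univ, Fintype.card_fin, vacuumChar, ← hr]
  module

end Fock

/-! ### The homomorphism to the tensor power and its kernel -/

/-- The homomorphism out of the induced module determined by a vector on which the parabolic
subalgebra acts as on the vacuum. -/
def liftVacuum {W : Type*} [AddCommGroup W] [Module ℂ W] [Module (U n) W]
    [IsScalarTower ℂ (U n) W] (w : W)
    (hw : ∀ x ∈ parabolic n, (ι x : U n) • w = vacuumChar p x • w) : VBar n p →ₗ[U n] W :=
  (inducingIdeal n p).liftQ (LinearMap.toSpanSingleton (U n) W w) <| by
    rw [inducingIdeal, Submodule.span_le]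
    rintro _ ⟨x, hx, rfl⟩
    simp [sub_smul, hw x hx]

theorem liftVacuum_v₀ {W : Type*} [AddCommGroup W] [Module ℂ W] [Module (U n) W]
    [IsScalarTower ℂ (U n) W] (w : W)
    (hw : ∀ x ∈ parabolic n, (ι x : U n) • w = vacuumChar p x • w) :
    liftVacuum w hw (v₀ n p) = w :=
  (Submodule.liftQ_apply _ _ _).trans (one_smul _ w)

/-- The vacuum of the tensor power, normalized to length one. -/
def unitVac (n p : ℕ) : Fock n p :=
  (((Real.sqrt (∑ x, ‖Fock.vac n p x‖ ^ 2))⁻¹ : ℝ) : ℂ) • Fock.vac n p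

theorem inner_unitVac (hp : 0 < p) : Fock.inner n p (unitVac n p) (unitVac n p) = 1 := by
  have hpos := Fock.sum_norm_sq_pos (Fock.vac_ne_zero (n := n) hp)
  rw [unitVac, map_smul, LinearMap.map_smulₛₗ₂, Fock.inner_self,
    Complex.conj_ofReal, smul_eq_mul, smul_eq_mul, ← Complex.ofReal_mul, ← Complex.ofReal_mul,
    ← mul_assoc, ← mul_inv, Real.mul_self_sqrt hpos.le, inv_mul_cancel₀ hpos.ne',
    Complex.ofReal_one]

theorem ι_smul_unitVac {x : Q n} (hx : x ∈ parabolic n) :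
    (ι x : U n) • unitVac n p = vacuumChar p x • unitVac n p := by
  rw [Fock.ι_smul, unitVac, map_smul, Fock.act_vac hx, smul_comm]

/-- The homomorphism from the induced module to the tensor power. -/
def toFock (n p : ℕ) : VBar n p →ₗ[U n] Fock n p :=
  liftVacuum (unitVac n p) fun _ => ι_smul_unitVac

/-- The pullback of the inner product of the tensor power along a linear map. -/
def pullback {W : Type} [AddCommGroup W] [Module ℂ W] (φ : W →ₗ[ℂ] Fock n p) : SesqForm W :=
  LinearMap.mk₂'ₛₗ (starRingEnd ℂ) (RingHom.id ℂ) (fun v w => Fock.inner n p (φ v) (φ w))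
    (by simp) (by simp) (by simp) (by simp)

theorem pullback_apply {W : Type} [AddCommGroup W] [Module ℂ W] (φ : W →ₗ[ℂ] Fock n p) (v w : W) :
    pullback φ v w = Fock.inner n p (φ v) (φ w) := rfl

theorem isFockForm_pullback_toFock (hp : 0 < p) :
    IsFockForm (pullback ((toFock n p).restrictScalars ℂ)) where
  hermitian v w := Fock.inner_hermitian _ _
  vacuum := by
    rw [pullback_apply, LinearMap.restrictScalars_apply, toFock, liftVacuum_v₀, inner_unitVac hp]
  adjoint_b i v w := by
    simp only [pullback_apply, LinearMap.restrictScalars_apply, map_smul]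
    exact Fock.inner_ι_e_smul _ _ _ _ _
  adjoint_f i v w := by
    simp only [pullback_apply, LinearMap.restrictScalars_apply, map_smul]
    exact Fock.inner_ι_e_smul _ _ _ _ _

theorem ker_toFock_ne_top (hp : 0 < p) : LinearMap.ker (toFock n p) ≠ ⊤ := by
  intro htop
  have h₀ : v₀ n p ∈ LinearMap.ker (toFock n p) := htop ▸ Submodule.mem_top
  have h := (isFockForm_pullback_toFock (n := n) hp).vacuum
  rw [pullback_apply, LinearMap.restrictScalars_apply, LinearMap.mem_ker.mp h₀, map_zero] at h
  exact zero_ne_one h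

theorem M_eq_ker_toFock (hp : 0 < p) : M n p = LinearMap.ker (toFock n p) := by
  have hH := isFockForm_pullback_toFock (n := n) hp
  apply le_antisymm
  · refine sSup_le fun N hN v hv => ?_
    by_contra hne
    have h : Fock.inner n p (toFock n p v) (toFock n p v) = 0 := hH.apply_eq_zero_of_mem hN hv v
    rw [Fock.inner_self, Complex.ofReal_eq_zero] at h
    exact (Fock.sum_norm_sq_pos hne).ne' h
  · exact le_sSup (ker_toFock_ne_top hp)

/-- The injective homomorphism from the quotient module to the tensor power. -/
def quotientToFock (hp : 0 < p) : V n p →ₗ[U n] Fock n p :=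
  (M n p).liftQ (toFock n p) (M_eq_ker_toFock hp).le

theorem quotientToFock_injective (hp : 0 < p) :
    Function.Injective (quotientToFock (n := n) hp) := by
  rw [← LinearMap.ker_eq_bot, quotientToFock]
  exact Submodule.ker_liftQ_eq_bot _ _ _ (M_eq_ker_toFock hp).ge

end QFock

end

theorem proposition6 (n p : ℕ) (hp : 0 < p) :
    IsGreatest {N : Submodule (QFock.U n) (QFock.VBar n p) | N ≠ ⊤} (QFock.M n p) ∧
    (∃! H : QFock.SesqForm (QFock.VBar n p), QFock.IsFockForm H) ∧
    ∀ H : QFock.SesqForm (QFock.VBar n p), QFock.IsFockForm H →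
      (∀ v ∈ QFock.M n p, ∀ w : QFock.VBar n p, H v w = 0 ∧ H w v = 0) ∧
      ∃ K : QFock.SesqForm (QFock.V n p),
        (∀ v w : QFock.VBar n p,
          K (Submodule.Quotient.mk v) (Submodule.Quotient.mk w) = H v w) ∧
        QFock.IsHermitianForm K ∧
        ∀ x : QFock.V n p, x ≠ 0 → 0 < (K x x).re := by
  have hfock := QFock.isFockForm_pullback_toFock (n := n) hp
  have hM : QFock.M n p ≠ ⊤ :=
    (QFock.M_eq_ker_toFock hp).trans_ne (QFock.ker_toFock_ne_top hp)
  refine ⟨⟨hM, fun N hN => le_sSup hN⟩, ⟨_, hfock, fun H hH => hH.unique hfock⟩, fun H hH => ?_⟩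
  refine ⟨fun v hv w => ?_, ?_⟩
  · have h := hH.apply_eq_zero_of_mem hM hv w
    exact ⟨h, by rw [hH.hermitian, h, map_zero]⟩
  · obtain rfl := hH.unique hfock
    refine ⟨QFock.pullback ((QFock.quotientToFock hp).restrictScalars ℂ), fun v w => rfl,
      fun v w => QFock.Fock.inner_hermitian _ _, fun x hx => ?_⟩
    rw [QFock.pullback_apply, QFock.Fock.inner_self, Complex.ofReal_re]
    exact QFock.Fock.sum_norm_sq_pos
      ((map_ne_zero_iff _ (QFock.quotientToFock_injective hp)).mpr hx)
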